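/- Theorem 2 (dimensional Prékopa theorem). Let $n\ge 0$ be an integer, let $\Omega\subset\mathbb R^{n+1}=\mathbb R\times\mathbb R^n$ be convex and open, and let $\varphi:\Omega\to(0,\infty)$ be a $C^2$ function. For $t\in\mathbb R$ let $\Omega(t)=\{x\in\mathbb R^n : (t,x)\in\Omega\}$. Integrals below take values in $[0,\infty]$, and $0^{-a}=\infty$, $\infty^{-a}=0$, $\infty^{a}=\infty$ for $a>0$. (i) If $\varphi$ is convex on $\Omega$ and $\beta>n$ is real, then the function $$\phi(t)=\left(\int_{\Omega(t)}\varphi(t,x)^{-\beta}\,dx\right)^{-\frac1{\beta-n}}$$ is convex on $\mathbb R$ as a function with values in $[0,\infty]$ (its value is $\infty$ where $\Omega(t)$ is empty). (ii) If $\varphi$ is concave on $\Omega$ and $\beta>0$ is real, then the function $$\phi(t)=\left(\int_{\Omega(t)}\varphi(t,x)^{\beta}\,dx\right)^{\frac1{\beta+n}}$$ is concave, as a function with values in $[0,\infty]$, on the convex set $\{t\in\mathbb R : \Omega(t)\ne\emptyset\}$. -/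

import Mathlib

open MeasureTheory
open scoped NNReal ENNReal

/-- The section `Ω(t) = {x ∈ ℝⁿ : (t, x) ∈ Ω}` of a set `Ω ⊆ ℝ × ℝⁿ`. -/
def sliceAt {n : ℕ} (Ω : Set (ℝ × EuclideanSpace ℝ (Fin n))) (t : ℝ) :
    Set (EuclideanSpace ℝ (Fin n)) :=
  {x | (t, x) ∈ Ω}

/-- The integral `∫_{Ω(t)} φ(t, x) ^ p dx` with respect to Lebesgue measure on `ℝⁿ`, as an element
of `[0, ∞]`. It is used for `φ > 0` on `Ω`. -/
noncomputable def sliceIntegral {n : ℕ} (Ω : Set (ℝ × EuclideanSpace ℝ (Fin n)))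
    (φ : ℝ × EuclideanSpace ℝ (Fin n) → ℝ) (p : ℝ) (t : ℝ) : ℝ≥0∞ :=
  ∫⁻ x in sliceAt Ω t, ENNReal.ofReal (φ (t, x) ^ p)

/-! Extend `φ` by `∞` (convex case) or `0` (concave case) off `Ω`. This preserves Jensen's
inequality and the integrals, so only functions `F` on a product space with values in `[0, ∞]`
remain. Integrate out one real variable at a time: if `F` is convex, so is `(∫ F^(-β))^(-1/(β-1))`,
whose power `-(β-1)` is the integral again. The exponents therefore telescope, and Tonelli gives an
induction on `n`. In the concave case `β-1` becomes `β+1`.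

For one variable, divide the slices at `z` and `w` by levels `m`, `n` just above their infima (just
below their suprema) and truncate at 1. One-dimensional Brunn–Minkowski on superlevel sets of equal
height, integrated by the layer-cake formula, gives `a m^β A + b n^β B ≤ (a m + b n)^β I`, or its
analogue with `-β`. Here `A`, `B` are the truncated integrals and `I` is the full integral of the
combined slice. Convexity of `(U, u) ↦ U^p u^(1-p)` then eliminates the levels, and monotone
convergence removes the truncation. -/

/-! ### Brunn–Minkowski on the line and its functional form -/

/-- One-dimensional Brunn–Minkowski inequality for subsets of a convex set. -/
theorem volume_add_le_volume_of_convex {S T R : Set ℝ} {a b : ℝ≥0} (hS : S.Nonempty)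
    (hT : T.Nonempty) (hR : Convex ℝ R)
    (h : ∀ x ∈ S, ∀ y ∈ T, (a : ℝ) * x + b * y ∈ R) :
    a * volume S + b * volume T ≤ volume R := by
  have key : ∀ x ∈ S, ∀ x' ∈ S, ∀ y ∈ T, ∀ y' ∈ T,
      (a : ℝ≥0∞) * edist x x' + b * edist y y' ≤ volume R := by
    have key' : ∀ x ∈ S, ∀ x' ∈ S, ∀ y ∈ T, ∀ y' ∈ T, x ≤ x' → y ≤ y' →
        (a : ℝ≥0∞) * edist x x' + b * edist y y' ≤ volume R := by
      intro x hx x' hx' y hy y' hy' hxx hyy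
      have hsub : Set.Icc ((a : ℝ) * x + b * y) (a * x' + b * y') ⊆ R :=
        hR.ordConnected.out (h x hx y hy) (h x' hx' y' hy')
      refine le_trans (le_of_eq ?_) (measure_mono hsub)
      rw [Real.volume_Icc, edist_comm x, edist_comm y, edist_dist, edist_dist, Real.dist_eq,
        Real.dist_eq, abs_of_nonneg (sub_nonneg.2 hxx), abs_of_nonneg (sub_nonneg.2 hyy),
        ← ENNReal.ofReal_coe_nnreal, ← ENNReal.ofReal_coe_nnreal,
        ← ENNReal.ofReal_mul a.coe_nonneg, ← ENNReal.ofReal_mul b.coe_nonneg, ← ENNReal.ofReal_add]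
      · congr 1; ring
      · exact mul_nonneg a.2 (sub_nonneg.2 hxx)
      · exact mul_nonneg b.2 (sub_nonneg.2 hyy)
    intro x hx x' hx' y hy y' hy'
    rcases le_total x x' with h1 | h1 <;> rcases le_total y y' with h2 | h2
    · exact key' x hx x' hx' y hy y' hy' h1 h2
    · rw [edist_comm y]; exact key' x hx x' hx' y' hy' y hy h1 h2
    · rw [edist_comm x]; exact key' x' hx' x hx y hy y' hy' h1 h2
    · rw [edist_comm y, edist_comm x]; exact key' x' hx' x hx y' hy' y hy h1 h2
  obtain ⟨x₀, hx₀⟩ := hS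
  obtain ⟨y₀, hy₀⟩ := hT
  -- Volume is at most diameter, so pairs of points suffice and neither set needs to be measurable.
  have hSd : volume S ≤ ⨆ p : S × S, edist (p.1 : ℝ) p.2 :=
    (Real.volume_le_diam S).trans <| Metric.ediam_le fun x hx y hy =>
      le_iSup (fun p : S × S => edist (p.1 : ℝ) p.2) (⟨x, hx⟩, ⟨y, hy⟩)
  have hTd : volume T ≤ ⨆ p : T × T, edist (p.1 : ℝ) p.2 :=
    (Real.volume_le_diam T).trans <| Metric.ediam_le fun x hx y hy =>
      le_iSup (fun p : T × T => edist (p.1 : ℝ) p.2) (⟨x, hx⟩, ⟨y, hy⟩)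
  have : Nonempty (S × S) := ⟨(⟨x₀, hx₀⟩, ⟨x₀, hx₀⟩)⟩
  have : Nonempty (T × T) := ⟨(⟨y₀, hy₀⟩, ⟨y₀, hy₀⟩)⟩
  calc a * volume S + b * volume T
      ≤ a * (⨆ p : S × S, edist (p.1 : ℝ) p.2) + b * ⨆ p : T × T, edist (p.1 : ℝ) p.2 := by gcongr
    _ ≤ volume R := by
      rw [ENNReal.mul_iSup, ENNReal.mul_iSup]
      exact ENNReal.iSup_add_iSup_le fun p q =>
        key _ p.1.2 _ p.2.2 _ q.1.2 _ q.2.2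

/-- Layer-cake formula for functions with values in `[0, 1]`. -/
theorem lintegral_eq_lintegral_Ioo_meas_lt {f : ℝ → ℝ≥0∞} (hf : Measurable f)
    (hf1 : ∀ x, f x ≤ 1) :
    ∫⁻ x, f x = ∫⁻ t in Set.Ioo (0 : ℝ) 1, volume {x | ENNReal.ofReal t < f x} := by
  have h1 : ∫⁻ x, f x = ∫⁻ x, ENNReal.ofReal (f x).toReal :=
    lintegral_congr fun x => (ENNReal.ofReal_toReal ((hf1 x).trans_lt ENNReal.one_lt_top).ne).symm
  have hset : ∀ t ∈ Set.Ioi (0 : ℝ),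
      {x | t < (f x).toReal} = {x | ENNReal.ofReal t < f x} := by
    intro t ht
    ext x
    exact (ENNReal.ofReal_lt_iff_lt_toReal (le_of_lt ht)
      ((hf1 x).trans_lt ENNReal.one_lt_top).ne).symm
  rw [h1, lintegral_eq_lintegral_meas_lt _ (.of_forall fun x => ENNReal.toReal_nonneg)
    hf.ennreal_toReal.aemeasurable, setLIntegral_congr_fun measurableSet_Ioi
      (fun t ht => by rw [hset t ht]), ← Set.Ioo_union_Ici_eq_Ioi zero_lt_one,
    lintegral_union measurableSet_Ici]
  · rw [setLIntegral_congr_fun (g := fun _ => 0) measurableSet_Ici]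
    · simp
    · intro t ht
      convert measure_empty (μ := (volume : Measure ℝ))
      ext x
      simp only [Set.mem_ofPred_eq, Set.mem_empty_iff_false, iff_false, not_lt]
      exact (hf1 x).trans (by simpa using ht)
  · exact Set.disjoint_left.2 fun t ht ht' => absurd ht.2 (not_lt.2 ht')

/-- Both functions have supremum 1, so at every height below 1 both superlevel sets are nonempty.
Brunn–Minkowski would fail if one of them were empty. -/
theorem lintegral_add_le_lintegral_of_superlevel {f g h : ℝ → ℝ≥0∞} (hf : Measurable f)
    (hg : Measurable g) (hh : Measurable h) (hf1 : ∀ x, f x ≤ 1) (hg1 : ∀ x, g x ≤ 1)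
    (hh1 : ∀ x, h x ≤ 1) (hfs : ∀ t < 1, ∃ x, t < f x) (hgs : ∀ t < 1, ∃ x, t < g x)
    (hconv : ∀ t, Convex ℝ {x | t < h x}) {a b : ℝ≥0}
    (H : ∀ t x y, t < f x → t < g y → t < h ((a : ℝ) * x + b * y)) :
    a * (∫⁻ x, f x) + b * (∫⁻ x, g x) ≤ ∫⁻ x, h x := by
  rw [lintegral_eq_lintegral_Ioo_meas_lt hf hf1, lintegral_eq_lintegral_Ioo_meas_lt hg hg1,
    lintegral_eq_lintegral_Ioo_meas_lt hh hh1]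
  have hanti : ∀ k : ℝ → ℝ≥0∞, Measurable fun t : ℝ => volume {x | ENNReal.ofReal t < k x} :=
    fun k => Antitone.measurable fun s t hst => measure_mono fun x hx =>
      (ENNReal.ofReal_le_ofReal hst).trans_lt hx
  rw [← lintegral_const_mul _ (hanti f), ← lintegral_const_mul _ (hanti g),
    ← lintegral_add_left ((hanti f).const_mul _)]
  refine setLIntegral_mono (hanti h) fun t ht => ?_
  have ht1 : ENNReal.ofReal t < 1 := by simpa using ht.2
  exact volume_add_le_volume_of_convex (hfs _ ht1) (hgs _ ht1) (hconv _)
    fun x hx y hy => H _ x y hx hy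

/-! ### Power inequalities and truncation in `[0, ∞]` -/

/-- Jensen for `t ↦ t^p` at the points `U/u`, `V/v` with weights `a u/c`, `b v/c`, where `c = a u +
b v`. The weights sum to 1 whatever `a + b` is. -/
theorem ENNReal.rpow_add_le_mul_rpow {a b : ℝ≥0} {U V u v : ℝ≥0∞} {p : ℝ} (hp : 1 ≤ p)
    (ha : a ≠ 0) (hu : u ≠ 0) (hu' : u ≠ ∞) (hv' : v ≠ ∞) (hv : v ≠ 0) :
    (a * U + b * V) ^ p ≤
      (a * u + b * v) ^ (p - 1) * (a * (U ^ p * u ^ (1 - p)) + b * (V ^ p * v ^ (1 - p))) := by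
  have hp0 : 0 ≤ p := by linarith
  have ha' : (a : ℝ≥0∞) ≠ 0 := by exact_mod_cast ha
  set c : ℝ≥0∞ := a * u + b * v with hc
  have hc0 : c ≠ 0 := by simp [hc, ha', hu]
  have hct : c ≠ ∞ := by simp [hc, ENNReal.mul_eq_top, hu', hv']
  have hJ := ENNReal.rpow_arith_mean_le_arith_mean2_rpow (a * u / c) (b * v / c) (U / u) (V / v)
    (by rw [← ENNReal.add_div, ← hc, ENNReal.div_self hc0 hct]) hp
  have e1 : ∀ (d : ℝ≥0) (w W : ℝ≥0∞), w ≠ 0 → w ≠ ∞ →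
      d * w / c * (W / w) = c⁻¹ * (d * W) := by
    intro d w W hw hw'
    rw [div_eq_mul_inv, div_eq_mul_inv]
    calc d * w * c⁻¹ * (W * w⁻¹) = c⁻¹ * (d * W) * (w * w⁻¹) := by ring
      _ = _ := by rw [ENNReal.mul_inv_cancel hw hw', mul_one]
  have e2 : ∀ (d : ℝ≥0) (w W : ℝ≥0∞), w ≠ 0 → w ≠ ∞ →
      d * w / c * (W / w) ^ p = c⁻¹ * (d * (W ^ p * w ^ (1 - p))) := by
    intro d w W hw hw'
    rw [ENNReal.div_rpow_of_nonneg _ _ hp0, div_eq_mul_inv, div_eq_mul_inv,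
      sub_eq_add_neg, ENNReal.rpow_add _ _ hw hw', ENNReal.rpow_one, ENNReal.rpow_neg]
    ring
  rw [e1 a u U hu hu', e1 b v V hv hv', e2 a u U hu hu', e2 b v V hv hv', ← mul_add, ← mul_add,
    ENNReal.mul_rpow_of_nonneg _ _ hp0] at hJ
  have hcp0 : c ^ p ≠ 0 := by simp [ENNReal.rpow_eq_zero_iff, hc0, hct]
  have hcpt : c ^ p ≠ ∞ := by simp [ENNReal.rpow_eq_top_iff, hc0, hct]
  calc (a * U + b * V) ^ p = c ^ p * (c⁻¹ ^ p * (a * U + b * V) ^ p) := by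
        rw [← mul_assoc, ENNReal.inv_rpow, ENNReal.mul_inv_cancel hcp0 hcpt, one_mul]
    _ ≤ c ^ p * (c⁻¹ * (a * (U ^ p * u ^ (1 - p)) + b * (V ^ p * v ^ (1 - p)))) := by gcongr
    _ = _ := by
        rw [← mul_assoc, sub_eq_add_neg p, ENNReal.rpow_add _ _ hc0 hct, ENNReal.rpow_neg_one]

theorem tendsto_lintegral_rpow_max {X : Type*} [MeasurableSpace X] {μ : Measure X}
    {f : X → ℝ≥0∞} (hf : Measurable f) {β : ℝ} (hβ : 0 ≤ β) {s : ℝ≥0∞} (hs : ∀ x, s ≤ f x)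
    {u : ℕ → ℝ≥0∞} (hu : Antitone u) (hus : Filter.Tendsto u Filter.atTop (nhds s)) :
    Filter.Tendsto (fun k => ∫⁻ x, (max (f x) (u k)) ^ (-β) ∂μ) Filter.atTop
      (nhds (∫⁻ x, f x ^ (-β) ∂μ)) := by
  refine lintegral_tendsto_of_tendsto_of_monotone
    (fun k => ((hf.max measurable_const).pow_const _).aemeasurable)
    (.of_forall fun x k l hkl => ?_) (.of_forall fun x => ?_)
  · simp only [ENNReal.rpow_neg]
    exact ENNReal.inv_le_inv.2 (ENNReal.rpow_le_rpow (max_le_max le_rfl (hu hkl)) hβ)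
  · refine ((ENNReal.continuous_rpow_const (y := -β)).tendsto _).comp ?_
    simpa [hs x] using (tendsto_const_nhds (x := f x)).max hus

theorem tendsto_lintegral_rpow_min {X : Type*} [MeasurableSpace X] {μ : Measure X}
    {f : X → ℝ≥0∞} (hf : Measurable f) {β : ℝ} (hβ : 0 ≤ β) {s : ℝ≥0∞} (hs : ∀ x, f x ≤ s)
    {u : ℕ → ℝ≥0∞} (hu : Monotone u) (hus : Filter.Tendsto u Filter.atTop (nhds s)) :
    Filter.Tendsto (fun k => ∫⁻ x, (min (f x) (u k)) ^ β ∂μ) Filter.atTop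
      (nhds (∫⁻ x, f x ^ β ∂μ)) := by
  refine lintegral_tendsto_of_tendsto_of_monotone
    (fun k => ((hf.min measurable_const).pow_const _).aemeasurable)
    (.of_forall fun x k l hkl => ?_) (.of_forall fun x => ?_)
  · exact ENNReal.rpow_le_rpow (min_le_min le_rfl (hu hkl)) hβ
  · refine ((ENNReal.continuous_rpow_const (y := β)).tendsto _).comp ?_
    simpa [hs x] using (tendsto_const_nhds (x := f x)).min hus

theorem lt_max_one_rpow_neg_iff {β : ℝ} (hβ : 0 < β) {t r : ℝ≥0∞} :
    t < (max r 1) ^ (-β) ↔ t < 1 ∧ r < t ^ (-(1 / β)) := by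
  have hβ' : 0 < 1 / β := by positivity
  have h : t < (max r 1) ^ (-β) ↔ max r 1 < t ^ (-(1 / β)) := by
    rw [ENNReal.rpow_neg, ENNReal.rpow_neg, ENNReal.lt_inv_iff_lt_inv,
      ← ENNReal.rpow_lt_rpow_iff hβ', ← ENNReal.rpow_mul, mul_one_div_cancel hβ.ne',
      ENNReal.rpow_one, ENNReal.inv_rpow]
  rw [h, max_lt_iff, and_comm]
  refine and_congr ?_ Iff.rfl
  rw [ENNReal.rpow_neg, ENNReal.lt_inv_iff_lt_inv, inv_one]
  nth_rw 1 [← ENNReal.one_rpow (1 / β)]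
  exact ENNReal.rpow_lt_rpow_iff hβ'

theorem lt_min_one_rpow_iff {β : ℝ} (hβ : 0 < β) {t r : ℝ≥0∞} :
    t < (min r 1) ^ β ↔ t < 1 ∧ t ^ (1 / β) < r := by
  have hβ' : 0 < 1 / β := by positivity
  rw [← ENNReal.rpow_lt_rpow_iff hβ', ← ENNReal.rpow_mul, mul_one_div_cancel hβ.ne',
    ENNReal.rpow_one, lt_min_iff, and_comm]
  refine and_congr ?_ Iff.rfl
  nth_rw 1 [← ENNReal.one_rpow (1 / β)]
  exact ENNReal.rpow_lt_rpow_iff hβ'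

theorem ENNReal.max_rpow_eq {m : ℝ≥0∞} (hm : m ≠ 0) (hm' : m ≠ ∞) (r : ℝ≥0∞) (β : ℝ) :
    (max (r / m) 1) ^ (-β) = m ^ β * (max r m) ^ (-β) := by
  have h : max (r / m) 1 = max r m * m⁻¹ := by
    rw [max_mul_of_nonneg _ _ (zero_le), ENNReal.mul_inv_cancel hm hm', div_eq_mul_inv]
  rw [h, ENNReal.mul_rpow_of_ne_zero (lt_max_of_lt_right (pos_iff_ne_zero.2 hm)).ne'
    (ENNReal.inv_ne_zero.2 hm'), ENNReal.inv_rpow, ENNReal.rpow_neg m, inv_inv, mul_comm]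

theorem ENNReal.min_rpow_eq {m : ℝ≥0∞} (hm : m ≠ 0) (hm' : m ≠ ∞) (r : ℝ≥0∞) {β : ℝ}
    (hβ : 0 ≤ β) : (min (r / m) 1) ^ β = m ^ (-β) * (min r m) ^ β := by
  have h : min (r / m) 1 = min r m * m⁻¹ := by
    rw [min_mul_of_nonneg _ _ (zero_le), ENNReal.mul_inv_cancel hm hm', div_eq_mul_inv]
  rw [h, ENNReal.mul_rpow_of_nonneg _ _ hβ, ENNReal.inv_rpow, ENNReal.rpow_neg, mul_comm]

theorem ENNReal.mul_add_mul_lt {a b : ℝ≥0} (ha : a ≠ 0) (hb : b ≠ 0) {x y x' y' : ℝ≥0∞}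
    (hx : x < x') (hy : y < y') : a * x + b * y < a * x' + b * y' :=
  ENNReal.add_lt_add
    ((ENNReal.mul_lt_mul_iff_right (by exact_mod_cast ha) ENNReal.coe_ne_top).2 hx)
    ((ENNReal.mul_lt_mul_iff_right (by exact_mod_cast hb) ENNReal.coe_ne_top).2 hy)

/-! ### Jensen convexity and concavity with values in `[0, ∞]` -/

/-- Convexity of a function with values in `[0, ∞]` on a real vector space. -/
def JensenConvex {V : Type*} [AddCommGroup V] [Module ℝ V] (F : V → ℝ≥0∞) : Prop :=
  ∀ z w : V, ∀ a b : ℝ≥0, a + b = 1 → F ((a : ℝ) • z + (b : ℝ) • w) ≤ a * F z + b * F w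

/-- Concavity of a function with values in `[0, ∞]` on its support. -/
def JensenConcave {V : Type*} [AddCommGroup V] [Module ℝ V] (F : V → ℝ≥0∞) : Prop :=
  ∀ z w : V, F z ≠ 0 → F w ≠ 0 → ∀ a b : ℝ≥0, a + b = 1 →
    a * F z + b * F w ≤ F ((a : ℝ) • z + (b : ℝ) • w)

section

variable {V : Type*} [AddCommGroup V] [Module ℝ V] {F : V → ℝ≥0∞}

theorem JensenConvex.of_pos
    (h : ∀ z w : V, ∀ a b : ℝ≥0, a ≠ 0 → b ≠ 0 → a + b = 1 →
      F ((a : ℝ) • z + (b : ℝ) • w) ≤ a * F z + b * F w) : JensenConvex F := by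
  intro z w a b hab
  rcases eq_or_ne a 0 with rfl | ha
  · obtain rfl : b = 1 := by simpa using hab
    simp
  rcases eq_or_ne b 0 with rfl | hb
  · obtain rfl : a = 1 := by simpa using hab
    simp
  exact h z w a b ha hb hab

theorem JensenConcave.of_pos
    (h : ∀ z w : V, F z ≠ 0 → F w ≠ 0 → ∀ a b : ℝ≥0, a ≠ 0 → b ≠ 0 → a + b = 1 →
      a * F z + b * F w ≤ F ((a : ℝ) • z + (b : ℝ) • w)) : JensenConcave F := by
  intro z w hz hw a b hab
  rcases eq_or_ne a 0 with rfl | ha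
  · obtain rfl : b = 1 := by simpa using hab
    simp
  rcases eq_or_ne b 0 with rfl | hb
  · obtain rfl : a = 1 := by simpa using hab
    simp
  exact h z w hz hw a b ha hb hab

theorem JensenConvex.convex_lt (hF : JensenConvex F) (R : ℝ≥0∞) : Convex ℝ {z | F z < R} := by
  intro z hz w hw a b ha hb hab
  lift a to ℝ≥0 using ha
  lift b to ℝ≥0 using hb
  have hab' : a + b = 1 := by exact_mod_cast hab
  calc F ((a : ℝ) • z + (b : ℝ) • w) ≤ a * F z + b * F w := hF z w a b hab'
    _ ≤ a * max (F z) (F w) + b * max (F z) (F w) := by gcongr <;> simp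
    _ = max (F z) (F w) := by
      rw [← add_mul, ← ENNReal.coe_add, hab', ENNReal.coe_one, one_mul]
    _ < R := max_lt hz hw

theorem JensenConcave.convex_lt (hF : JensenConcave F) (R : ℝ≥0∞) : Convex ℝ {z | R < F z} := by
  intro z hz w hw a b ha hb hab
  lift a to ℝ≥0 using ha
  lift b to ℝ≥0 using hb
  have hab' : a + b = 1 := by exact_mod_cast hab
  calc R < min (F z) (F w) := lt_min hz hw
    _ = a * min (F z) (F w) + b * min (F z) (F w) := by
      rw [← add_mul, ← ENNReal.coe_add, hab', ENNReal.coe_one, one_mul]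
    _ ≤ a * F z + b * F w := by gcongr <;> simp
    _ ≤ F ((a : ℝ) • z + (b : ℝ) • w) :=
      hF z w (ne_bot_of_gt hz) (ne_bot_of_gt hw) a b hab'

end

/-! ### Integrating out one real variable -/

section

variable {E : Type*} [AddCommGroup E] [Module ℝ E] {F : E × ℝ → ℝ≥0∞}

/-- The level `c = a m + b n` is chosen so that `F < s m` at one point and `F < s n` at the other
give `F < s c` at the combination. This is the superlevel hypothesis with `s = t^(-1/β)`. The
truncation on the right can be dropped, since it only lowers that integral. -/
theorem JensenConvex.lintegral_truncated_le (hF : JensenConvex F)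
    (hmeas : ∀ z, Measurable fun x => F (z, x)) {β : ℝ} (hβ : 0 < β) {z w : E} {a b : ℝ≥0}
    (ha : a ≠ 0) (hb : b ≠ 0) (hab : a + b = 1) {m n : ℝ≥0∞} (hm : m ≠ 0) (hm' : m ≠ ∞)
    (hn : n ≠ 0) (hn' : n ≠ ∞) (hzm : ∃ x, F (z, x) < m) (hwn : ∃ x, F (w, x) < n) :
    a * (m ^ β * ∫⁻ x, (max (F (z, x)) m) ^ (-β)) +
      b * (n ^ β * ∫⁻ x, (max (F (w, x)) n) ^ (-β)) ≤
      (a * m + b * n) ^ β * ∫⁻ x, F ((a : ℝ) • z + (b : ℝ) • w, x) ^ (-β) := by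
  set c : ℝ≥0∞ := a * m + b * n with hc
  have hc0 : c ≠ 0 := by simp [hc, ha, hm]
  have hct : c ≠ ∞ := by simp [hc, ENNReal.mul_eq_top, hm', hn']
  have hmeas1 : ∀ (z : E) (r : ℝ≥0∞), Measurable fun x => (max (F (z, x) / r) 1) ^ (-β) :=
    fun z r => (((hmeas z).div_const r).max measurable_const).pow_const _
  have hle1 : ∀ r : ℝ≥0∞, (max r 1) ^ (-β) ≤ 1 := fun r => by
    rw [ENNReal.rpow_neg, ENNReal.inv_le_one]
    exact ENNReal.one_le_rpow (le_max_right _ _) hβ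
  have hone : ∀ (z : E) (r : ℝ≥0∞), (∃ x, F (z, x) < r) → ∀ t < 1, ∃ x,
      t < (max (F (z, x) / r) 1) ^ (-β) := by
    rintro z r ⟨x, hx⟩ t ht
    refine ⟨x, ?_⟩
    rwa [max_eq_right (ENNReal.div_le_of_le_mul (by simpa using hx.le)), ENNReal.one_rpow]
  have key := lintegral_add_le_lintegral_of_superlevel (hmeas1 z m) (hmeas1 w n)
    (hmeas1 ((a : ℝ) • z + (b : ℝ) • w) c) (fun _ => hle1 _) (fun _ => hle1 _) (fun _ => hle1 _)
    (hone z m hzm) (hone w n hwn) (a := a) (b := b) ?_ ?_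
  · simp only [ENNReal.max_rpow_eq hm hm', ENNReal.max_rpow_eq hn hn',
      ENNReal.max_rpow_eq hc0 hct] at key
    rw [lintegral_const_mul _ (((hmeas _).max measurable_const).pow_const _),
      lintegral_const_mul _ (((hmeas _).max measurable_const).pow_const _),
      lintegral_const_mul _ (((hmeas _).max measurable_const).pow_const _)] at key
    refine key.trans (mul_le_mul_right (lintegral_mono fun x => ?_) _)
    simp only [ENNReal.rpow_neg]
    exact ENNReal.inv_le_inv.2 (ENNReal.rpow_le_rpow (le_max_left _ _) hβ.le)
  · intro t
    simp only [lt_max_one_rpow_neg_iff hβ, ENNReal.div_lt_iff (.inl hc0) (.inl hct)]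
    intro x hx y hy α δ hα hδ hαδ
    refine ⟨hx.1, ?_⟩
    have := hF.convex_lt _ (x := ((a : ℝ) • z + (b : ℝ) • w, x)) hx.2
      (y := ((a : ℝ) • z + (b : ℝ) • w, y)) hy.2 hα hδ hαδ
    simpa only [Set.mem_ofPred_eq, Prod.smul_mk, Prod.mk_add_mk, ← add_smul, hαδ, one_smul] using this
  · intro t x y
    simp only [lt_max_one_rpow_neg_iff hβ, ENNReal.div_lt_iff (.inl hc0) (.inl hct),
      ENNReal.div_lt_iff (.inl hm) (.inl hm'), ENNReal.div_lt_iff (.inl hn) (.inl hn')]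
    rintro ⟨ht, hx⟩ ⟨-, hy⟩
    refine ⟨ht, ?_⟩
    calc F ((a : ℝ) • z + (b : ℝ) • w, a * x + b * y) ≤ a * F (z, x) + b * F (w, y) :=
          hF (z, x) (w, y) a b hab
      _ < a * (t ^ (-(1 / β)) * m) + b * (t ^ (-(1 / β)) * n) :=
          ENNReal.mul_add_mul_lt ha hb hx hy
      _ = _ := by rw [hc]; ring

theorem JensenConcave.lintegral_truncated_le (hF : JensenConcave F)
    (hmeas : ∀ z, Measurable fun x => F (z, x)) {β : ℝ} (hβ : 0 < β) {z w : E} {a b : ℝ≥0}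
    (ha : a ≠ 0) (hb : b ≠ 0) (hab : a + b = 1) {m n : ℝ≥0∞} (hm : m ≠ 0) (hm' : m ≠ ∞)
    (hn : n ≠ 0) (hn' : n ≠ ∞) (hzm : ∃ x, m < F (z, x)) (hwn : ∃ x, n < F (w, x)) :
    a * (m ^ (-β) * ∫⁻ x, (min (F (z, x)) m) ^ β) +
      b * (n ^ (-β) * ∫⁻ x, (min (F (w, x)) n) ^ β) ≤
      (a * m + b * n) ^ (-β) * ∫⁻ x, F ((a : ℝ) • z + (b : ℝ) • w, x) ^ β := by
  set c : ℝ≥0∞ := a * m + b * n with hc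
  have hc0 : c ≠ 0 := by simp [hc, ha, hm]
  have hct : c ≠ ∞ := by simp [hc, ENNReal.mul_eq_top, hm', hn']
  have hmeas1 : ∀ (z : E) (r : ℝ≥0∞), Measurable fun x => (min (F (z, x) / r) 1) ^ β :=
    fun z r => (((hmeas z).div_const r).min measurable_const).pow_const _
  have hle1 : ∀ r : ℝ≥0∞, (min r 1) ^ β ≤ 1 := fun r =>
    ENNReal.rpow_le_one (min_le_right _ _) hβ.le
  have hone : ∀ (z : E) (r : ℝ≥0∞), r ≠ 0 → r ≠ ∞ → (∃ x, r < F (z, x)) → ∀ t < 1, ∃ x,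
      t < (min (F (z, x) / r) 1) ^ β := by
    rintro z r hr hr' ⟨x, hx⟩ t ht
    refine ⟨x, ?_⟩
    rwa [min_eq_right ((ENNReal.le_div_iff_mul_le (.inl hr) (.inl hr')).2 (by simpa using hx.le)),
      ENNReal.one_rpow]
  have key := lintegral_add_le_lintegral_of_superlevel (hmeas1 z m) (hmeas1 w n)
    (hmeas1 ((a : ℝ) • z + (b : ℝ) • w) c) (fun _ => hle1 _) (fun _ => hle1 _) (fun _ => hle1 _)
    (hone z m hm hm' hzm) (hone w n hn hn' hwn) (a := a) (b := b) ?_ ?_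
  · simp only [ENNReal.min_rpow_eq hm hm' _ hβ.le, ENNReal.min_rpow_eq hn hn' _ hβ.le,
      ENNReal.min_rpow_eq hc0 hct _ hβ.le] at key
    rw [lintegral_const_mul _ (((hmeas _).min measurable_const).pow_const _),
      lintegral_const_mul _ (((hmeas _).min measurable_const).pow_const _),
      lintegral_const_mul _ (((hmeas _).min measurable_const).pow_const _)] at key
    refine key.trans (mul_le_mul_right (lintegral_mono fun x => ?_) _)
    exact ENNReal.rpow_le_rpow (min_le_left _ _) hβ.le
  · intro t
    simp only [lt_min_one_rpow_iff hβ, ENNReal.lt_div_iff_mul_lt (.inl hc0) (.inl hct)]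
    intro x hx y hy α δ hα hδ hαδ
    refine ⟨hx.1, ?_⟩
    have := hF.convex_lt _ (x := ((a : ℝ) • z + (b : ℝ) • w, x)) hx.2
      (y := ((a : ℝ) • z + (b : ℝ) • w, y)) hy.2 hα hδ hαδ
    simpa only [Set.mem_ofPred_eq, Prod.smul_mk, Prod.mk_add_mk, ← add_smul, hαδ, one_smul] using this
  · intro t x y
    simp only [lt_min_one_rpow_iff hβ, ENNReal.lt_div_iff_mul_lt (.inl hc0) (.inl hct),
      ENNReal.lt_div_iff_mul_lt (.inl hm) (.inl hm'), ENNReal.lt_div_iff_mul_lt (.inl hn) (.inl hn')]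
    rintro ⟨ht, hx⟩ ⟨-, hy⟩
    refine ⟨ht, ?_⟩
    calc t ^ (1 / β) * c = a * (t ^ (1 / β) * m) + b * (t ^ (1 / β) * n) := by rw [hc]; ring
      _ < a * F (z, x) + b * F (w, y) := ENNReal.mul_add_mul_lt ha hb hx hy
      _ ≤ F ((a : ℝ) • z + (b : ℝ) • w, a * x + b * y) :=
          hF (z, x) (w, y) (ne_bot_of_gt hx) (ne_bot_of_gt hy) a b hab

/-- The power inequality is applied with `U = m`, `V = n`, `u = A^(-1/γ)`, `v = B^(-1/γ)` and `p = γ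
+ 1`, so that `u^(1-p) = A` and `v^(1-p) = B`. The factor `c^(γ+1)` then cancels and leaves `1 ≤ I
Z^γ`. -/
theorem ENNReal.rpow_le_of_perspective_neg {a b : ℝ≥0} (ha : a ≠ 0) (hb : b ≠ 0)
    {m n A B I : ℝ≥0∞} (hm : m ≠ 0) (hm' : m ≠ ∞) (hn' : n ≠ ∞) {γ : ℝ}
    (hγ : 0 < γ)
    (h : a * (m ^ (γ + 1) * A) + b * (n ^ (γ + 1) * B) ≤ (a * m + b * n) ^ (γ + 1) * I)
    (hn : n ≠ 0) :
    I ^ (-(1 / γ)) ≤ a * A ^ (-(1 / γ)) + b * B ^ (-(1 / γ)) := by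
  have hγ' : 0 < 1 / γ := by positivity
  set c : ℝ≥0∞ := a * m + b * n with hc
  have hc0 : c ≠ 0 := by simp [hc, ha, hm]
  have hct : c ≠ ∞ := by simp [hc, ENNReal.mul_eq_top, hm', hn']
  have hcp0 : c ^ (γ + 1) ≠ 0 := by simp [ENNReal.rpow_eq_zero_iff, hc0, hct]
  have hcpt : c ^ (γ + 1) ≠ ∞ := by simp [ENNReal.rpow_eq_top_iff, hc0, hct]
  have hpow : ∀ {r : ℝ≥0∞}, r ≠ 0 → r ≠ ∞ → r ^ (γ + 1) ≠ 0 := fun h0 ht => by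
    simp [ENNReal.rpow_eq_zero_iff, h0, ht]
  rcases eq_or_ne A 0 with rfl | hA0
  · simp [ENNReal.zero_rpow_of_neg, hγ, ha]
  rcases eq_or_ne B 0 with rfl | hB0
  · simp [ENNReal.zero_rpow_of_neg, hγ, hb]
  have hItop : c ^ (γ + 1) * I = ∞ → I = ∞ := by
    intro hI
    rcases ENNReal.mul_eq_top.1 hI with h1 | h1
    · exact h1.2
    · exact absurd h1.1 hcpt
  rcases eq_or_ne A ∞ with rfl | hAt
  · rw [hItop (top_le_iff.1 (le_trans (by simp [ENNReal.mul_top, hpow hm hm', ha]) h))]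
    simp [hγ]
  rcases eq_or_ne B ∞ with rfl | hBt
  · rw [hItop (top_le_iff.1 (le_trans (by simp [ENNReal.mul_top, hpow hn hn', hb]) h))]
    simp [hγ]
  have hX : ∀ {r : ℝ≥0∞}, r ≠ 0 → r ≠ ∞ → r ^ (-(1 / γ)) ≠ 0 ∧ r ^ (-(1 / γ)) ≠ ∞ :=
    fun h0 ht => by simp [ENNReal.rpow_eq_zero_iff, ENNReal.rpow_eq_top_iff, h0, ht]
  have hXp : ∀ r : ℝ≥0∞, (r ^ (-(1 / γ))) ^ (1 - (γ + 1)) = r := fun r => by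
    rw [← ENNReal.rpow_mul, show -(1 / γ) * (1 - (γ + 1)) = 1 by field_simp; ring,
      ENNReal.rpow_one]
  set Z : ℝ≥0∞ := a * A ^ (-(1 / γ)) + b * B ^ (-(1 / γ)) with hZ
  have hZ0 : Z ≠ 0 := by simp [hZ, ha, hA0, hAt]
  have hZt : Z ≠ ∞ := by simp [hZ, ENNReal.mul_eq_top, hA0, hAt, hB0, hBt]
  have hJ := ENNReal.rpow_add_le_mul_rpow (b := b) (U := m) (V := n) (p := γ + 1) (by linarith) ha
    (hX hA0 hAt).1 (hX hA0 hAt).2 (hX hB0 hBt).2 (hX hB0 hBt).1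
  rw [hXp, hXp, ← hZ, add_sub_cancel_right, ← hc] at hJ
  have h1 : 1 ≤ I * Z ^ γ := by
    have : c ^ (γ + 1) * 1 ≤ c ^ (γ + 1) * (I * Z ^ γ) := by
      calc c ^ (γ + 1) * 1 ≤ Z ^ γ * (c ^ (γ + 1) * I) := by
            rw [mul_one]; exact hJ.trans (by gcongr)
        _ = _ := by ring
    exact (ENNReal.mul_le_mul_iff_right hcp0 hcpt).1 this
  have h2 : I⁻¹ ≤ Z ^ γ := (ENNReal.inv_le_iff_le_mul
    (fun h => absurd h (by simp [ENNReal.rpow_eq_top_iff, hZ0, hZt]))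
    (fun _ => by simp [ENNReal.rpow_eq_zero_iff, hZ0, hZt])).2 h1
  calc I ^ (-(1 / γ)) = I⁻¹ ^ (1 / γ) := by rw [ENNReal.inv_rpow, ENNReal.rpow_neg]
    _ ≤ (Z ^ γ) ^ (1 / γ) := ENNReal.rpow_le_rpow h2 hγ'.le
    _ = Z := by rw [← ENNReal.rpow_mul, mul_one_div_cancel hγ.ne', ENNReal.rpow_one]

/-- Here the levels take the other role: `u = m`, `v = n`, while `U`, `V` are the roots of `A`, `B`.
The factors `c^β` and `c^(-β)` cancel. -/
theorem ENNReal.le_rpow_of_perspective {a b : ℝ≥0} (ha : a ≠ 0)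
    {m n A B I : ℝ≥0∞} (hm : m ≠ 0) (hm' : m ≠ ∞) (hn : n ≠ 0) (hn' : n ≠ ∞) {β : ℝ}
    (hβ : 0 < β)
    (h : a * (m ^ (-β) * A) + b * (n ^ (-β) * B) ≤ (a * m + b * n) ^ (-β) * I) :
    a * A ^ (1 / (β + 1)) + b * B ^ (1 / (β + 1)) ≤ I ^ (1 / (β + 1)) := by
  set c : ℝ≥0∞ := a * m + b * n with hc
  have hc0 : c ≠ 0 := by simp [hc, ha, hm]
  have hct : c ≠ ∞ := by simp [hc, ENNReal.mul_eq_top, hm', hn']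
  have hγ : 0 < β + 1 := by linarith
  have hXp : ∀ r : ℝ≥0∞, (r ^ (1 / (β + 1))) ^ (β + 1) = r := fun r => by
    rw [← ENNReal.rpow_mul, one_div_mul_cancel hγ.ne', ENNReal.rpow_one]
  have hJ := ENNReal.rpow_add_le_mul_rpow (b := b) (U := A ^ (1 / (β + 1)))
    (V := B ^ (1 / (β + 1))) (p := β + 1) (by linarith) ha hm hm' hn' hn
  rw [hXp, hXp, ← hc, add_sub_cancel_right, show 1 - (β + 1) = -β by ring, mul_comm A,
    mul_comm B] at hJ
  refine (ENNReal.rpow_le_rpow_iff hγ).1 ?_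
  rw [hXp I]
  calc _ ≤ c ^ β * (c ^ (-β) * I) := hJ.trans (by gcongr)
    _ = I := by rw [← mul_assoc, ← ENNReal.rpow_add _ _ hc0 hct, add_neg_cancel,
      ENNReal.rpow_zero, one_mul]

theorem JensenConvex.lintegral_rpow (hF : JensenConvex F)
    (hmeas : ∀ z, Measurable fun x => F (z, x)) {γ : ℝ} (hγ : 0 < γ) :
    JensenConvex fun z => (∫⁻ x, F (z, x) ^ (-(γ + 1))) ^ (-(1 / γ)) := by
  refine JensenConvex.of_pos fun z w a b ha hb hab => ?_
  have hβ : 0 < γ + 1 := by linarith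
  -- If the integral vanishes because the slice is identically `∞`, the right side is `∞` and there
  -- is nothing to prove. Otherwise the levels decrease strictly to the infimum, staying above it so
  -- that the sublevel sets are nonempty.
  have hseq : ∀ z : E, (∫⁻ x, F (z, x) ^ (-(γ + 1))) = 0 ∨ ∃ u : ℕ → ℝ≥0∞,
      (∀ k, u k ≠ 0 ∧ u k ≠ ∞ ∧ ∃ x, F (z, x) < u k) ∧
      Filter.Tendsto (fun k => ∫⁻ x, (max (F (z, x)) (u k)) ^ (-(γ + 1))) Filter.atTop
        (nhds (∫⁻ x, F (z, x) ^ (-(γ + 1)))) := by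
    intro z
    rcases eq_or_ne (⨅ x, F (z, x)) ∞ with hs | hs
    · left
      have hβ' : -(γ + 1) < 0 := by linarith
      simp only [fun x => iInf_eq_top.1 hs x, ENNReal.top_rpow_of_neg hβ', lintegral_zero]
    · right
      obtain ⟨u, hu, hus, hulim⟩ := exists_seq_strictAnti_tendsto' (lt_top_iff_ne_top.2 hs)
      exact ⟨u, fun k => ⟨ne_bot_of_gt (hus k).1, (hus k).2.ne, iInf_lt_iff.1 (hus k).1⟩,
        tendsto_lintegral_rpow_max (hmeas z) hβ.le (fun x => iInf_le _ x) hu.antitone hulim⟩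
  rcases hseq z with hz | ⟨u, hu, hulim⟩
  · rw [hz, ENNReal.zero_rpow_of_neg (by simpa using hγ)]
    simp [ha]
  rcases hseq w with hw | ⟨v, hv, hvlim⟩
  · rw [hw, ENNReal.zero_rpow_of_neg (by simpa using hγ)]
    simp [hb]
  have hc : ∀ d : ℝ≥0, (d : ℝ≥0∞) ≠ ∞ := fun d => ENNReal.coe_ne_top
  refine ge_of_tendsto' ((ENNReal.Tendsto.const_mul
    (((ENNReal.continuous_rpow_const (y := -(1 / γ))).tendsto _).comp hulim)
      (.inr (hc a))).add (ENNReal.Tendsto.const_mul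
    (((ENNReal.continuous_rpow_const (y := -(1 / γ))).tendsto _).comp hvlim) (.inr (hc b))))
    fun k => ?_
  obtain ⟨hu0, hut, hux⟩ := hu k
  obtain ⟨hv0, hvt, hvx⟩ := hv k
  exact ENNReal.rpow_le_of_perspective_neg ha hb hu0 hut hvt hγ
    (hF.lintegral_truncated_le hmeas hβ ha hb hab hu0 hut hv0 hvt hux hvx) hv0

theorem JensenConcave.lintegral_rpow (hF : JensenConcave F)
    (hmeas : ∀ z, Measurable fun x => F (z, x)) {β : ℝ} (hβ : 0 < β) :
    JensenConcave fun z => (∫⁻ x, F (z, x) ^ β) ^ (1 / (β + 1)) := by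
  have hγ : 0 < β + 1 := by linarith
  refine JensenConcave.of_pos fun z w hz hw a b ha hb hab => ?_
  have hseq : ∀ z : E, (∫⁻ x, F (z, x) ^ β) ^ (1 / (β + 1)) ≠ 0 → ∃ u : ℕ → ℝ≥0∞,
      (∀ k, u k ≠ 0 ∧ u k ≠ ∞ ∧ ∃ x, u k < F (z, x)) ∧
      Filter.Tendsto (fun k => ∫⁻ x, (min (F (z, x)) (u k)) ^ β) Filter.atTop
        (nhds (∫⁻ x, F (z, x) ^ β)) := by
    intro z hz
    -- A nonzero integral forces a positive supremum. Levels strictly below it are finite even when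
    -- it is `∞`.
    have hs : 0 < ⨆ x, F (z, x) := by
      refine pos_iff_ne_zero.2 fun hs => hz ?_
      simp only [ENNReal.iSup_eq_zero] at hs
      simp [hs, hβ, hγ]
    obtain ⟨u, hu, hus, hulim⟩ := exists_seq_strictMono_tendsto' hs
    exact ⟨u, fun k => ⟨(hus k).1.ne', ne_top_of_lt (hus k).2, lt_iSup_iff.1 (hus k).2⟩,
      tendsto_lintegral_rpow_min (hmeas z) hβ.le (fun x => le_iSup (fun x => F (z, x)) x)
        hu.monotone hulim⟩
  obtain ⟨u, hu, hulim⟩ := hseq z hz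
  obtain ⟨v, hv, hvlim⟩ := hseq w hw
  have hc : ∀ d : ℝ≥0, (d : ℝ≥0∞) ≠ ∞ := fun d => ENNReal.coe_ne_top
  refine le_of_tendsto' ((ENNReal.Tendsto.const_mul
    (((ENNReal.continuous_rpow_const (y := 1 / (β + 1))).tendsto _).comp hulim)
      (.inr (hc a))).add (ENNReal.Tendsto.const_mul
    (((ENNReal.continuous_rpow_const (y := 1 / (β + 1))).tendsto _).comp hvlim) (.inr (hc b))))
    fun k => ?_
  obtain ⟨hu0, hut, hux⟩ := hu k
  obtain ⟨hv0, hvt, hvx⟩ := hv k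
  exact ENNReal.le_rpow_of_perspective ha hu0 hut hv0 hvt hβ
    (hF.lintegral_truncated_le hmeas hβ ha hb hab hu0 hut hv0 hvt hux hvx)

end

/-! ### Induction on the dimension -/

theorem lintegral_fin_succ {n : ℕ} {f : (Fin (n + 1) → ℝ) → ℝ≥0∞} (hf : Measurable f) :
    ∫⁻ y, f y = ∫⁻ x : Fin n → ℝ, ∫⁻ x₀ : ℝ, f (Fin.cons x₀ x) := by
  have he := (volume_preserving_piFinSuccAbove (fun _ : Fin (n + 1) => ℝ) 0).symm
  rw [← he.lintegral_comp hf, Measure.volume_eq_prod,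
    lintegral_prod_symm' (fun p => f ((MeasurableEquiv.piFinSuccAbove (fun _ => ℝ) 0).symm p))
      (hf.comp (MeasurableEquiv.measurable _))]
  simp [MeasurableEquiv.piFinSuccAbove, Fin.insertNthEquiv, Fin.insertNth_zero']

theorem measurable_fin_cons {n : ℕ} :
    Measurable fun p : ℝ × (Fin n → ℝ) => (Fin.cons p.1 p.2 : Fin (n + 1) → ℝ) :=
  measurable_pi_iff.2 fun i => by
    refine Fin.cases ?_ (fun j => ?_) i
    · simpa using measurable_fst
    · simp only [Fin.cons_succ]; fun_prop

theorem smul_add_smul_fin_cons {E : Type*} [AddCommGroup E] [Module ℝ E] {n : ℕ} (a b : ℝ)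
    (p q : (E × (Fin n → ℝ)) × ℝ) :
    (((a • p + b • q).1.1, Fin.cons (a • p + b • q).2 (a • p + b • q).1.2) :
      E × (Fin (n + 1) → ℝ)) =
      a • (p.1.1, Fin.cons p.2 p.1.2) + b • (q.1.1, Fin.cons q.2 q.1.2) := by
  refine Prod.ext rfl (funext fun i => ?_)
  refine Fin.cases ?_ (fun j => ?_) i <;> simp

theorem Measurable.comp_fin_cons {E : Type*} [MeasurableSpace E] {n : ℕ} {F : E × (Fin (n + 1) → ℝ) → ℝ≥0∞} (hF : Measurable F) :
    Measurable fun p : (E × (Fin n → ℝ)) × ℝ => F (p.1.1, Fin.cons p.2 p.1.2) :=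
  hF.comp ((measurable_fst.comp measurable_fst).prodMk (measurable_fin_cons.comp
    (measurable_snd.prodMk (measurable_snd.comp measurable_fst))))

section

variable {E : Type*} [AddCommGroup E] [Module ℝ E]

theorem JensenConvex.comp_fin_cons {n : ℕ} {F : E × (Fin (n + 1) → ℝ) → ℝ≥0∞}
    (hF : JensenConvex F) :
    JensenConvex fun p : (E × (Fin n → ℝ)) × ℝ => F (p.1.1, Fin.cons p.2 p.1.2) := by
  intro p q a b hab
  dsimp only
  rw [smul_add_smul_fin_cons]
  exact hF _ _ a b hab

theorem JensenConcave.comp_fin_cons {n : ℕ} {F : E × (Fin (n + 1) → ℝ) → ℝ≥0∞}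
    (hF : JensenConcave F) :
    JensenConcave fun p : (E × (Fin n → ℝ)) × ℝ => F (p.1.1, Fin.cons p.2 p.1.2) := by
  intro p q hp hq a b hab
  dsimp only
  rw [smul_add_smul_fin_cons]
  exact hF _ _ hp hq a b hab

variable [MeasurableSpace E]

/-- The parameter space `E` must vary: after the first coordinate is integrated out, the remaining
ones join the parameter. For `n = 0` the integral over a point returns `F`. -/
theorem JensenConvex.lintegral_pi_rpow {n : ℕ} {F : E × (Fin n → ℝ) → ℝ≥0∞}
    (hF : JensenConvex F) (hmeas : Measurable F) {β : ℝ} (hβ : n < β) :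
    JensenConvex fun z => (∫⁻ x, F (z, x) ^ (-β)) ^ (-(1 / (β - n))) := by
  induction n generalizing β with
  | zero =>
    have hβ' : β ≠ 0 := by simpa using hβ.ne'
    have hz : ∀ z, (∫⁻ x, F (z, x) ^ (-β)) ^ (-(1 / (β - (0 : ℕ)))) = F (z, default) := by
      intro z
      rw [lintegral_unique, volume_pi, Measure.pi_of_empty _ default, measure_univ, mul_one,
        ← ENNReal.rpow_mul, Nat.cast_zero, sub_zero, neg_mul_neg, mul_one_div_cancel hβ',
        ENNReal.rpow_one]
      exact congrArg (fun x => F (z, x)) (Subsingleton.elim _ _)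
    intro z w a b hab
    simp only [hz]
    have := hF (z, default) (w, default) a b hab
    rwa [show (a : ℝ) • (z, default) + (b : ℝ) • (w, default) =
      ((a : ℝ) • z + (b : ℝ) • w, (default : Fin 0 → ℝ)) from
        Prod.ext rfl (Subsingleton.elim _ _)] at this
  | succ n ih =>
    push_cast at hβ
    have hγ : 0 < β - 1 := by have := n.cast_nonneg (α := ℝ); linarith
    have h1 := hF.comp_fin_cons.lintegral_rpow
      (fun z => hmeas.comp_fin_cons.comp measurable_prodMk_left) hγ
    have h2 := ih h1 ((hmeas.comp_fin_cons.pow_const _).lintegral_prod_right'.pow_const _)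
      (β := β - 1) (by linarith)
    intro z w a b hab
    have h3 := h2 z w a b hab
    -- The outer power `-(β - 1)` undoes the inner root, leaving an iterated integral of `F^(-β)`.
    simp only [← ENNReal.rpow_mul, show -(1 / (β - 1)) * -(β - 1) = 1 by field_simp,
      ENNReal.rpow_one, sub_add_cancel] at h3
    have hz : ∀ z, ∫⁻ x, F (z, x) ^ (-β) =
        ∫⁻ x : Fin n → ℝ, ∫⁻ x₀ : ℝ, F (z, Fin.cons x₀ x) ^ (-β) := fun z =>
      lintegral_fin_succ ((hmeas.comp measurable_prodMk_left).pow_const _)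
    simp only [hz]
    rwa [show β - ((n + 1 : ℕ) : ℝ) = β - 1 - n by push_cast; ring]

theorem JensenConcave.lintegral_pi_rpow {n : ℕ} {F : E × (Fin n → ℝ) → ℝ≥0∞}
    (hF : JensenConcave F) (hmeas : Measurable F) {β : ℝ} (hβ : 0 < β) :
    JensenConcave fun z => (∫⁻ x, F (z, x) ^ β) ^ (1 / (β + n)) := by
  induction n generalizing β with
  | zero =>
    have hz : ∀ z, (∫⁻ x, F (z, x) ^ β) ^ (1 / (β + (0 : ℕ))) = F (z, default) := by
      intro z
      rw [lintegral_unique, volume_pi, Measure.pi_of_empty _ default, measure_univ, mul_one,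
        ← ENNReal.rpow_mul, Nat.cast_zero, add_zero, mul_one_div_cancel hβ.ne',
        ENNReal.rpow_one]
      exact congrArg (fun x => F (z, x)) (Subsingleton.elim _ _)
    intro z w hz0 hw0 a b hab
    simp only [hz] at hz0 hw0 ⊢
    have := hF (z, default) (w, default) hz0 hw0 a b hab
    rwa [show (a : ℝ) • (z, default) + (b : ℝ) • (w, default) =
      ((a : ℝ) • z + (b : ℝ) • w, (default : Fin 0 → ℝ)) from
        Prod.ext rfl (Subsingleton.elim _ _)] at this
  | succ n ih =>
    have hγ : β + 1 ≠ 0 := by linarith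
    have h1 := hF.comp_fin_cons.lintegral_rpow
      (fun z => hmeas.comp_fin_cons.comp measurable_prodMk_left) hβ
    have h2 := ih h1 ((hmeas.comp_fin_cons.pow_const _).lintegral_prod_right'.pow_const _)
      (β := β + 1) (by linarith)
    have hz : ∀ z, ∫⁻ x, F (z, x) ^ β =
        ∫⁻ x : Fin n → ℝ, ∫⁻ x₀ : ℝ, F (z, Fin.cons x₀ x) ^ β := fun z =>
      lintegral_fin_succ ((hmeas.comp measurable_prodMk_left).pow_const _)
    simp only [← ENNReal.rpow_mul, one_div_mul_cancel hγ, ENNReal.rpow_one, ← hz] at h2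
    rwa [show β + ((n + 1 : ℕ) : ℝ) = β + 1 + n by push_cast; ring]

end

/-! ### From `φ` on `Ω` to its extension -/

/-- The extension of a function by a constant `c ∈ [0, ∞]` outside of a set, in the coordinates of
`ℝ × (Fin n → ℝ)`. -/
noncomputable def ofRealExtend {n : ℕ} (Ω : Set (ℝ × EuclideanSpace ℝ (Fin n)))
    (φ : ℝ × EuclideanSpace ℝ (Fin n) → ℝ) (c : ℝ≥0∞) (p : ℝ × (Fin n → ℝ)) : ℝ≥0∞ :=
  open Classical in
  if (p.1, WithLp.toLp 2 p.2) ∈ Ω then ENNReal.ofReal (φ (p.1, WithLp.toLp 2 p.2)) else c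

section

variable {n : ℕ} {Ω : Set (ℝ × EuclideanSpace ℝ (Fin n))}
  {φ : ℝ × EuclideanSpace ℝ (Fin n) → ℝ} {c : ℝ≥0∞}

theorem measurable_ofRealExtend (hΩ : MeasurableSet Ω) (hφ : ContinuousOn φ Ω) :
    Measurable (ofRealExtend Ω φ c) := by
  classical
  have h1 : Measurable fun p : ℝ × EuclideanSpace ℝ (Fin n) =>
      if p ∈ Ω then ENNReal.ofReal (φ p) else c := by
    exact (ENNReal.continuous_ofReal.comp_continuousOn hφ).measurable_piecewise
      (continuousOn_const (c := c)) hΩ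
  have h2 : Measurable fun p : ℝ × (Fin n → ℝ) =>
      ((p.1, WithLp.toLp 2 p.2) : ℝ × EuclideanSpace ℝ (Fin n)) :=
    measurable_fst.prodMk ((WithLp.measurable_toLp 2 _).comp measurable_snd)
  convert h1.comp h2 using 1
  ext p
  simp [ofRealExtend]

theorem sliceIntegral_eq_lintegral_ofRealExtend (hΩ : MeasurableSet Ω)
    (hφ_pos : ∀ z ∈ Ω, 0 < φ z) {p : ℝ} (hc : c ^ p = 0) (t : ℝ) :
    sliceIntegral Ω φ p t = ∫⁻ x, ofRealExtend Ω φ c (t, x) ^ p := by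
  classical
  have hS : MeasurableSet (sliceAt Ω t) := measurable_prodMk_left hΩ
  rw [sliceIntegral, ← lintegral_indicator hS,
    ← (PiLp.volume_preserving_toLp (Fin n)).lintegral_comp_emb
      (MeasurableEquiv.toLp 2 (Fin n → ℝ)).measurableEmbedding]
  refine lintegral_congr fun x => ?_
  by_cases hx : (t, WithLp.toLp 2 x) ∈ Ω
  · rw [Set.indicator_of_mem (s := sliceAt Ω t) hx, ofRealExtend, if_pos hx, ENNReal.ofReal_rpow_of_pos (hφ_pos _ hx)]
  · rw [Set.indicator_of_notMem (s := sliceAt Ω t) hx, ofRealExtend, if_neg hx, hc]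

theorem smul_add_smul_toLp (a b : ℝ) (z w : ℝ × (Fin n → ℝ)) :
    (((a • z + b • w).1, WithLp.toLp 2 (a • z + b • w).2) : ℝ × EuclideanSpace ℝ (Fin n)) =
      a • (z.1, WithLp.toLp 2 z.2) + b • (w.1, WithLp.toLp 2 w.2) := rfl

/-- With both weights nonzero, an endpoint outside `Ω` makes the right side `∞`. -/
theorem ConvexOn.jensenConvex_ofRealExtend (hφ : ConvexOn ℝ Ω φ) (hφ_pos : ∀ z ∈ Ω, 0 < φ z) :
    JensenConvex (ofRealExtend Ω φ ∞) := by
  refine JensenConvex.of_pos fun z w a b ha hb hab => ?_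
  by_cases hz : (z.1, WithLp.toLp 2 z.2) ∈ Ω
  swap
  · simp [ofRealExtend, hz, ha]
  by_cases hw : (w.1, WithLp.toLp 2 w.2) ∈ Ω
  swap
  · simp [ofRealExtend, hw, hb]
  have hab' : (a : ℝ) + b = 1 := by exact_mod_cast hab
  have hm := hφ.1 hz hw a.coe_nonneg b.coe_nonneg hab'
  have hle := hφ.2 hz hw a.coe_nonneg b.coe_nonneg hab'
  unfold ofRealExtend
  rw [smul_add_smul_toLp, if_pos hm, if_pos hz, if_pos hw, ← ENNReal.ofReal_coe_nnreal,
    ← ENNReal.ofReal_coe_nnreal, ← ENNReal.ofReal_mul a.coe_nonneg,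
    ← ENNReal.ofReal_mul b.coe_nonneg,
    ← ENNReal.ofReal_add (mul_nonneg a.coe_nonneg (hφ_pos _ hz).le)
      (mul_nonneg b.coe_nonneg (hφ_pos _ hw).le)]
  exact ENNReal.ofReal_le_ofReal hle

theorem ConcaveOn.jensenConcave_ofRealExtend (hφ : ConcaveOn ℝ Ω φ)
    (hφ_pos : ∀ z ∈ Ω, 0 < φ z) : JensenConcave (ofRealExtend Ω φ 0) := by
  intro z w hz0 hw0 a b hab
  have hz : (z.1, WithLp.toLp 2 z.2) ∈ Ω := by
    by_contra hz
    simp [ofRealExtend, hz] at hz0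
  have hw : (w.1, WithLp.toLp 2 w.2) ∈ Ω := by
    by_contra hw
    simp [ofRealExtend, hw] at hw0
  have hab' : (a : ℝ) + b = 1 := by exact_mod_cast hab
  have hm := hφ.1 hz hw a.coe_nonneg b.coe_nonneg hab'
  have hle := hφ.2 hz hw a.coe_nonneg b.coe_nonneg hab'
  unfold ofRealExtend
  rw [smul_add_smul_toLp, if_pos hm, if_pos hz, if_pos hw, ← ENNReal.ofReal_coe_nnreal,
    ← ENNReal.ofReal_coe_nnreal, ← ENNReal.ofReal_mul a.coe_nonneg,
    ← ENNReal.ofReal_mul b.coe_nonneg,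
    ← ENNReal.ofReal_add (mul_nonneg a.coe_nonneg (hφ_pos _ hz).le)
      (mul_nonneg b.coe_nonneg (hφ_pos _ hw).le)]
  exact ENNReal.ofReal_le_ofReal hle

theorem convex_setOf_sliceAt_nonempty (hΩ : Convex ℝ Ω) :
    Convex ℝ {t : ℝ | (sliceAt Ω t).Nonempty} := by
  rintro t ⟨x, hx⟩ s ⟨y, hy⟩ a b ha hb hab
  exact ⟨a • x + b • y, hΩ hx hy ha hb hab⟩

/-- Jensen concavity speaks only of points where the function is nonzero. This places every `t` with
a nonempty slice among them. -/
theorem sliceIntegral_ne_zero (hΩ : IsOpen Ω) (hφ : ContinuousOn φ Ω)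
    (hφ_pos : ∀ z ∈ Ω, 0 < φ z) (p : ℝ) {t : ℝ} (ht : (sliceAt Ω t).Nonempty) :
    sliceIntegral Ω φ p t ≠ 0 := by
  have hc : Continuous fun x : EuclideanSpace ℝ (Fin n) => (t, x) := by fun_prop
  have hS : IsOpen (sliceAt Ω t) := hΩ.preimage hc
  have hm : AEMeasurable (fun x => ENNReal.ofReal (φ (t, x) ^ p))
      (volume.restrict (sliceAt Ω t)) := by
    refine ContinuousOn.aemeasurable ?_ hS.measurableSet
    refine ENNReal.continuous_ofReal.comp_continuousOn ?_
    exact (hφ.comp hc.continuousOn fun x hx => hx).rpow_const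
      fun x hx => .inl (hφ_pos _ hx).ne'
  rw [sliceIntegral, Ne, lintegral_eq_zero_iff' hm, Filter.EventuallyEq,
    ae_restrict_iff' hS.measurableSet]
  intro h
  refine (hS.measure_pos volume ht).ne' (measure_mono_null (fun x hx => ?_) h)
  simp only [Set.mem_compl_iff, Set.mem_ofPred_eq, Pi.zero_apply, ENNReal.ofReal_eq_zero, not_le,
    Classical.not_imp]
  exact ⟨hx, Real.rpow_pos_of_pos (hφ_pos _ hx) _⟩

end

theorem theorem2 (n : ℕ) (Ω : Set (ℝ × EuclideanSpace ℝ (Fin n)))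
    (hΩ_open : IsOpen Ω) (hΩ_convex : Convex ℝ Ω)
    (φ : ℝ × EuclideanSpace ℝ (Fin n) → ℝ)
    (hφ_smooth : ContDiffOn ℝ 2 φ Ω) (hφ_pos : ∀ z ∈ Ω, 0 < φ z) :
    (ConvexOn ℝ Ω φ → ∀ β : ℝ, (n : ℝ) < β →
      ConvexOn ℝ≥0 (Set.univ : Set ℝ)
        (fun t : ℝ => sliceIntegral Ω φ (-β) t ^ (-(1 / (β - (n : ℝ)))))) ∧
    (ConcaveOn ℝ Ω φ → ∀ β : ℝ, 0 < β →
      ConcaveOn ℝ≥0 {t : ℝ | (sliceAt Ω t).Nonempty}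
        (fun t : ℝ => sliceIntegral Ω φ β t ^ (1 / (β + (n : ℝ))))) := by
  have hcont := hφ_smooth.continuousOn
  refine ⟨fun hφ β hβ => ⟨convex_univ, fun t _ s _ a b _ _ hab => ?_⟩,
    fun hφ β hβ => ⟨fun t ht s hs a b ha hb hab => ?_, fun t ht s hs a b _ _ hab => ?_⟩⟩
  · have hβ0 : 0 < β := n.cast_nonneg.trans_lt hβ
    simp only [sliceIntegral_eq_lintegral_ofRealExtend hΩ_open.measurableSet hφ_pos
      (ENNReal.top_rpow_of_neg (neg_lt_zero.2 hβ0))]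
    exact (hφ.jensenConvex_ofRealExtend hφ_pos).lintegral_pi_rpow
      (measurable_ofRealExtend hΩ_open.measurableSet hcont) hβ t s a b hab
  · exact convex_setOf_sliceAt_nonempty hΩ_convex ht hs a.coe_nonneg b.coe_nonneg
      (by exact_mod_cast hab)
  · have hβn : 0 < 1 / (β + n) := by positivity
    have hne : ∀ {r : ℝ}, (sliceAt Ω r).Nonempty → sliceIntegral Ω φ β r ^ (1 / (β + n)) ≠ 0 :=
      fun hr h => sliceIntegral_ne_zero hΩ_open hcont hφ_pos β hr
        ((ENNReal.rpow_eq_zero_iff_of_pos hβn).1 h)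
    have ht' := hne ht
    have hs' := hne hs
    simp only [sliceIntegral_eq_lintegral_ofRealExtend hΩ_open.measurableSet hφ_pos
      (ENNReal.zero_rpow_of_pos hβ)] at ht' hs' ⊢
    exact (hφ.jensenConcave_ofRealExtend hφ_pos).lintegral_pi_rpow
      (measurable_ofRealExtend hΩ_open.measurableSet hcont) hβ t s ht' hs' a b hab
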